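/- All graphs are finite and simple. For a connected graph $G$ let $d_G(u,v)$ be the number of edges of a shortest path between $u$ and $v$, let $\operatorname{diam}(G)=\max_{u,v}d_G(u,v)$, and let the Wiener index be $W(G)=\sum_{\{u,v\}\subseteq V(G)}d_G(u,v)$, the sum being over unordered pairs of vertices. Let $\mathfrak{T}_n(d)$ denote the family of all trees on $n$ vertices with diameter $d$. For positive integers $\ell,k,d$ let $T(\ell,k,d)$ be the caterpillar obtained from the path on $d$ vertices by attaching $\ell$ pendant vertices to one of its ends and $k$ pendant vertices to its other end. For $n\ge 9$ let $T_7=T(2,3,n-5)$, and let $T_9$ be the tree obtained from the path $v_0v_1\cdots v_{n-4}$ by attaching one pendant vertex to $v_{n-5}$, and a path $v_2\,x\,y$ with two new vertices $x,y$ at $v_2$. (i) For every $n\ge 10$, $T_7\in\mathfrak{T}_n(n-4)$ and $$W(T_7)=\frac{n^3-25n+84}{6},$$ and $T_7$ is, up to isomorphism, the unique tree with maximum Wiener index in $\mathfrak{T}_n(n-4)$: every $T\in\mathfrak{T}_n(n-4)$ satisfies $W(T)\le W(T_7)$, with equality if and only if $T\cong T_7$. (ii) For $n=9$, the trees $T_7$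 and $T_9$ are non-isomorphic members of $\mathfrak{T}_9(5)$ with $W(T_7)=W(T_9)=98$, and they are, up to isomorphism, exactly the trees with maximum Wiener index in $\mathfrak{T}_9(5)$: every $T\in\mathfrak{T}_9(5)$ satisfies $W(T)\le 98$, with equality if and only if $T\cong T_7$ or $T\cong T_9$. -/

import Mathlib

namespace WienerTrees

open Classical in
/-- The Wiener index `W(G)`: the sum of the distances over all unordered pairs of vertices.
(The diagonal pairs `s(v, v)` contribute `0`.) -/
noncomputable def wienerIndex {V : Type*} [Fintype V] (G : SimpleGraph V) : ℕ :=
  ∑ p : Sym2 V, Sym2.lift ⟨fun u v => G.dist u v, fun _ _ => SimpleGraph.dist_comm⟩ p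

/-- `G` belongs to the family `𝔗_n(d)` of trees on `n` vertices with diameter `d`. -/
def InTreeFamily {V : Type*} [Fintype V] (n d : ℕ) (G : SimpleGraph V) : Prop :=
  Fintype.card V = n ∧ G.IsTree ∧ G.diam = d

/-- The caterpillar `T(ℓ, k, d)`: the path `0, 1, …, d - 1` (the vertices `inl i`) together with
`ℓ` pendant vertices attached to its end `0` and `k` pendant vertices attached to its other
end `d - 1`. -/
def caterpillarT (ℓ k d : ℕ) : SimpleGraph (Fin d ⊕ (Fin ℓ ⊕ Fin k)) :=
  SimpleGraph.fromRel fun a b =>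
    match a, b with
    | .inl i, .inl j => i.val + 1 = j.val
    | .inl i, .inr (.inl _) => i.val = 0
    | .inl i, .inr (.inr _) => i.val + 1 = d
    | _, _ => False

/-- The tree `T₇ = T(2, 3, n - 5)`, intended for `n ≥ 9`. -/
def treeT7 (n : ℕ) : SimpleGraph (Fin (n - 5) ⊕ (Fin 2 ⊕ Fin 3)) :=
  caterpillarT 2 3 (n - 5)

/-- The tree `T₉`, intended for `n ≥ 9`: the path `v₀ v₁ ⋯ v_{n-4}` (the vertices `inl i`)
together with a path of two further vertices `inr 0`, `inr 1` hanging from `v₂`, and a pendant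
vertex `inr 2` attached to `v_{n-5}`. -/
def treeT9 (n : ℕ) : SimpleGraph (Fin (n - 3) ⊕ Fin 3) :=
  SimpleGraph.fromRel fun a b =>
    match a, b with
    | .inl i, .inl j => i.val + 1 = j.val
    | .inl i, .inr j => (i.val = 2 ∧ j = 0) ∨ (i.val + 5 = n ∧ j = 2)
    | .inr i, .inr j => i = 0 ∧ j = 1
    | _, _ => False

end WienerTrees

namespace WienerTrees

open SimpleGraph

/-! ### Distances -/

/-! Write `n = m + 5`. A tree of diameter `m + 1` on `n` vertices contains a geodesic on `m + 2`
vertices as an induced path, and connectedness and acyclicity let the other three vertices be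
attached one leaf at a time. This leaves four shapes: three pendants, a tail of length two plus a
pendant, a cherry, and a tail of length three. The diameter confines the attachment points.

Attaching a leaf at `u` raises the Wiener index by the transmission of `u` plus the old order
(`wienerIndex_addLeaf`), so every shape has an explicit index in terms of path transmissions.
Attaching at position `i` instead of position 1 lowers the path transmission by the loss `(i - 1) *
(m - i)`, which vanishes exactly at the inner extremes 1 and `m`.

Let `B` be the index of the path plus three times the transmission of position 1. The extremal tree
attains `B + 5m + 10`. Three pendants give at most this, because their pairwise distances sum to at
most `2(m - 1)`. A tail with a pendant gives at most `B + 4m + 14`, which ties only at `m = 4`; this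
is the source of `T₉`. The other two shapes fall strictly below. -/

theorem dist_eq_of_certificate {V : Type*} {G : SimpleGraph V} (f : V → V → ℕ)
    (h0 : ∀ u, f u u = 0) (h1 : ∀ u v w, G.Adj u v → f u w ≤ f v w + 1)
    (h2 : ∀ u w, u ≠ w → ∃ v, G.Adj u v ∧ f v w + 1 = f u w) (u w : V) :
    G.dist u w = f u w := by
  -- Descending along `h2` produces a walk of length `f u w`, while `h1` makes `f` a lower bound for
  -- the length of every walk.
  have walk : ∀ n u w, f u w = n → ∃ p : G.Walk u w, p.length = n := by
    intro n
    induction n with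
    | zero =>
      intro u w h
      by_cases huw : u = w
      · subst huw; exact ⟨Walk.nil, rfl⟩
      · obtain ⟨v, -, hv⟩ := h2 u w huw
        omega
    | succ n ih =>
      intro u w h
      have huw : u ≠ w := by
        rintro rfl
        have := h0 u
        omega
      obtain ⟨v, hadj, hv⟩ := h2 u w huw
      obtain ⟨p, hp⟩ := ih v w (by omega)
      exact ⟨Walk.cons hadj p, by simp [hp]⟩
  have lower : ∀ u w (p : G.Walk u w), f u w ≤ p.length := by
    intro u w p
    induction p with
    | nil => simp [h0]
    | cons hadj p ih =>
      exact (h1 _ _ _ hadj).trans (Nat.add_le_add_right ih 1)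
  obtain ⟨p, hp⟩ := walk _ u w rfl
  obtain ⟨q, hq⟩ := Reachable.exists_walk_length_eq_dist ⟨p⟩
  have h3 := lower u w q
  have h4 := dist_le p
  omega

theorem dist_map_le {V W : Type*} {G : SimpleGraph V} {H : SimpleGraph W} (hG : G.Connected)
    (φ : G →g H) (u v : V) : H.dist (φ u) (φ v) ≤ G.dist u v := by
  obtain ⟨p, hp⟩ := hG.exists_walk_length_eq_dist u v
  rw [← hp, ← Walk.length_map φ p]
  exact dist_le _

theorem dist_iso {V W : Type*} {G : SimpleGraph V} {H : SimpleGraph W} (hG : G.Connected)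
    (φ : G ≃g H) (u v : V) : H.dist (φ u) (φ v) = G.dist u v := by
  have hH : H.Connected := φ.connected_iff.1 hG
  refine le_antisymm (dist_map_le hG φ.toHom u v) ?_
  simpa using dist_map_le hH φ.symm.toHom (φ u) (φ v)

theorem pathGraph_dist {n : ℕ} (i j : Fin n) :
    (pathGraph n).dist i j = (i.val - j.val) + (j.val - i.val) := by
  refine dist_eq_of_certificate (fun i j : Fin n => (i.val - j.val) + (j.val - i.val))
    (fun u => by simp) (fun u v w h => ?_) (fun u w h => ?_) i j
  · rw [pathGraph_adj] at h
    omega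
  · have h' : u.val ≠ w.val := fun e => h (Fin.ext e)
    have := u.isLt
    have := w.isLt
    rcases Nat.lt_or_gt_of_ne h' with h'' | h''
    · refine ⟨⟨u + 1, by omega⟩, pathGraph_adj.2 (Or.inl rfl), ?_⟩
      dsimp only
      omega
    · refine ⟨⟨u - 1, by omega⟩, pathGraph_adj.2 (Or.inr ?_), ?_⟩
      all_goals simp only; omega

theorem diam_eq_of_forall_le {V : Type*} [Finite V] {G : SimpleGraph V} (hG : G.Connected)
    {d : ℕ} (hle : ∀ u v, G.dist u v ≤ d) {a b : V} (hab : G.dist a b = d) : G.diam = d := by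
  have : Nonempty V := hG.nonempty
  -- `diam` takes the default value 0 when `ediam` is infinite, so finiteness is needed before
  -- distances can be bounded by it.
  have hne : G.ediam ≠ ⊤ := connected_iff_ediam_ne_top.1 hG
  obtain ⟨u, v, huv⟩ := G.exists_dist_eq_diam
  exact le_antisymm (huv ▸ hle u v) (hab ▸ dist_le_diam hne)

/-! ### Transmission and the Wiener index -/

/-- The transmission of a vertex: the sum of its distances to all vertices. -/
noncomputable def transmission {V : Type*} [Fintype V] (G : SimpleGraph V) (u : V) : ℕ :=
  ∑ v, G.dist u v

/-- Ordered pairs are grouped by their unordered pair: an off-diagonal fibre has two elements with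
equal distance, and a diagonal fibre contributes 0. -/
theorem two_mul_wienerIndex {V : Type*} [Fintype V] (G : SimpleGraph V) :
    2 * wienerIndex G = ∑ u, transmission G u := by
  classical
  unfold wienerIndex transmission
  rw [← Fintype.sum_prod_type' (f := fun u v => G.dist u v),
    ← Finset.sum_fiberwise (Finset.univ : Finset (V × V)) (fun p => Sym2.mk p.1 p.2),
    Finset.mul_sum]
  refine Finset.sum_congr (by congr) fun p _ => ?_
  induction p using Sym2.ind with
  | _ a b =>
    by_cases hab : a = b
    · subst hab
      symm
      simp only [Sym2.lift_mk, dist_self, mul_zero]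
      refine Finset.sum_eq_zero fun q hq => ?_
      simp only [Finset.mem_filter, Finset.mem_univ, true_and, Sym2.eq_iff] at hq
      rcases hq with ⟨h1, h2⟩ | ⟨h1, h2⟩ <;> simp [h1, h2]
    · have : (Finset.univ.filter fun q : V × V => s(q.1, q.2) = s(a, b))
          = {(a, b), (b, a)} := by
        ext ⟨x, y⟩
        simp
      rw [this, Finset.sum_pair (by simp [hab])]
      simp only [Sym2.lift_mk, dist_comm (u := b)]
      ring

theorem transmission_iso {V W : Type*} [Fintype V] [Fintype W] {G : SimpleGraph V}
    {H : SimpleGraph W} (hG : G.Connected) (φ : G ≃g H) (u : V) :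
    transmission H (φ u) = transmission G u := by
  unfold transmission
  rw [← φ.toEquiv.sum_comp]
  exact Finset.sum_congr rfl fun v _ => dist_iso hG φ u v

theorem wienerIndex_iso {V W : Type*} [Fintype V] [Fintype W] {G : SimpleGraph V}
    {H : SimpleGraph W} (hG : G.Connected) (φ : G ≃g H) : wienerIndex H = wienerIndex G := by
  have h : 2 * wienerIndex H = 2 * wienerIndex G := by
    rw [two_mul_wienerIndex, two_mul_wienerIndex, ← φ.toEquiv.sum_comp]
    exact Finset.sum_congr rfl fun v _ => transmission_iso hG φ v
  omega

theorem InTreeFamily.of_iso {V W : Type*} [Fintype V] [Fintype W] {G : SimpleGraph V}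
    {H : SimpleGraph W} {n d : ℕ} (h : InTreeFamily n d G) (φ : G ≃g H) :
    InTreeFamily n d H := by
  obtain ⟨hc, ht, hd⟩ := h
  have hne : Nonempty V := ht.1.nonempty
  have hne' : G.ediam ≠ ⊤ := connected_iff_ediam_ne_top.1 ht.1
  obtain ⟨a, b, hab⟩ := G.exists_dist_eq_diam
  refine ⟨by rw [← hc, Fintype.card_congr φ.toEquiv], φ.isTree_iff.1 ht, ?_⟩
  refine diam_eq_of_forall_le (φ.connected_iff.1 ht.1) (fun u v => ?_)
    (a := φ a) (b := φ b) (by rw [dist_iso ht.1, hab, hd])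
  rw [← φ.apply_symm_apply u, ← φ.apply_symm_apply v, dist_iso ht.1, ← hd]
  exact dist_le_diam hne'

/-! ### Attaching a pendant vertex -/

/-- The graph obtained from `G` by attaching a new pendant vertex `none` at `u`. -/
def addLeaf {V : Type*} (G : SimpleGraph V) (u : V) : SimpleGraph (Option V) where
  Adj a b :=
    match a, b with
    | none, none => False
    | none, some w => w = u
    | some w, none => w = u
    | some v, some w => G.Adj v w
  symm := ⟨by
    rintro (_ | a) (_ | b) h
    · exact h
    · exact h
    · exact h
    · exact SimpleGraph.Adj.symm (G := G) h⟩
  loopless := ⟨by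
    rintro (_ | a) h
    · exact h
    · exact G.irrefl h⟩

section addLeaf

variable {V : Type*} {G : SimpleGraph V} {u : V}

@[simp] theorem addLeaf_adj_none_none : (addLeaf G u).Adj none none ↔ False := Iff.rfl
@[simp] theorem addLeaf_adj_none_some {w : V} : (addLeaf G u).Adj none (some w) ↔ w = u := Iff.rfl
@[simp] theorem addLeaf_adj_some_none {w : V} : (addLeaf G u).Adj (some w) none ↔ w = u := Iff.rfl
@[simp] theorem addLeaf_adj_some_some {v w : V} :
    (addLeaf G u).Adj (some v) (some w) ↔ G.Adj v w := Iff.rfl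

theorem addLeaf_connected (hG : G.Connected) : (addLeaf G u).Connected := by
  have hs : ∀ v, (addLeaf G u).Reachable (some u) (some v) := fun v =>
    (hG u v).map (⟨some, fun h => h⟩ : G →g addLeaf G u)
  have hr : ∀ a, (addLeaf G u).Reachable (some u) a := by
    rintro (_ | v)
    · exact Adj.reachable (addLeaf_adj_some_none.2 rfl)
    · exact hs v
  exact ⟨fun a b => (hr a).symm.trans (hr b)⟩

/-- The distance function of `addLeaf G u`, in terms of that of `G`. -/
def leafDist (f : V → V → ℕ) (u : V) : Option V → Option V → ℕ
  | none, none => 0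
  | none, some w => f u w + 1
  | some v, none => f v u + 1
  | some v, some w => f v w

/-- `leafDist` is a distance certificate: any step towards a target in `G` remains available, and
the new vertex is reached only through `u`. -/
theorem addLeaf_dist (hG : G.Connected) : (addLeaf G u).dist = leafDist G.dist u := by
  have step : ∀ x y, x ≠ y → ∃ z, G.Adj x z ∧ G.dist z y + 1 = G.dist x y := by
    intro x y hxy
    obtain ⟨p, hp⟩ := hG.exists_walk_length_eq_dist x y
    cases p with
    | nil => exact absurd rfl hxy
    | cons hadj q =>
      refine ⟨_, hadj, ?_⟩
      have h1 := dist_le q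
      have h2 := hG.dist_triangle (u := x) (v := _) (w := y) |>.trans
        (Nat.add_le_add_right (dist_eq_one_iff_adj.2 hadj).le _)
      simp only [Walk.length_cons] at hp
      omega
  have tri : ∀ x y z, G.Adj x y → G.dist x z ≤ G.dist y z + 1 := by
    intro x y z h
    have h2 := hG.dist_triangle (u := x) (v := y) (w := z)
    have h3 := dist_eq_one_iff_adj.2 h
    omega
  ext a b
  refine dist_eq_of_certificate (leafDist G.dist u) ?_ ?_ ?_ a b
  · rintro (_ | x) <;> simp [leafDist]
  · rintro (_ | x) (_ | y) (_ | z) h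
    · simp [leafDist]
    · simp [leafDist]
    · simp [leafDist]
    · have : y = u := h
      subst this; simp [leafDist]
    · simp at h; subst h; simp [leafDist]
    · simp at h; subst h; simp only [leafDist]; omega
    · have := tri x y u h
      simp only [leafDist]; omega
    · exact tri x y z h
  · rintro (_ | x) (_ | y) h
    · exact absurd rfl h
    · exact ⟨some u, rfl, rfl⟩
    · by_cases hx : x = u
      · subst hx
        exact ⟨none, rfl, by simp [leafDist]⟩
      · obtain ⟨z, hz, hd⟩ := step x u hx
        exact ⟨some z, hz, by simp only [leafDist]; omega⟩
    · obtain ⟨z, hz, hd⟩ := step x y (fun e => h (by rw [e]))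
      exact ⟨some z, hz, hd⟩

/-- Connectedness survives, and both the vertex count and the edge count grow by one. -/
theorem addLeaf_isTree [Finite V] (hG : G.IsTree) : (addLeaf G u).IsTree := by
  rw [isTree_iff_connected_and_card] at hG ⊢
  refine ⟨addLeaf_connected hG.1, ?_⟩
  have hE : (addLeaf G u).edgeSet = insert s(none, some u) (Sym2.map some '' G.edgeSet) := by
    ext e
    induction e using Sym2.ind with
    | _ a b =>
      simp only [mem_edgeSet, Set.mem_insert_iff, Set.mem_image]
      constructor
      · intro h
        rcases a with _ | a <;> rcases b with _ | b
        · exact absurd h id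
        · have : b = u := h
          subst this; exact Or.inl rfl
        · have : a = u := h
          subst this; exact Or.inl Sym2.eq_swap
        · exact Or.inr ⟨s(a, b), h, rfl⟩
      · rintro (h | ⟨e, he, h⟩)
        · rw [← mem_edgeSet, h]
          exact (rfl : u = u)
        · rw [← mem_edgeSet, ← h]
          induction e using Sym2.ind with
          | _ x y => exact he
  have hnot : s(none, some u) ∉ Sym2.map some '' G.edgeSet := by
    rintro ⟨e, -, he⟩
    induction e using Sym2.ind with
    | _ x y => simp at he
  rw [hE, Nat.card_coe_set_eq, Set.ncard_insert_of_notMem hnot (Set.toFinite _),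
    Set.ncard_image_of_injective _ (Sym2.map.injective (Option.some_injective V)),
    ← Nat.card_coe_set_eq, hG.2, Finite.card_option]

theorem transmission_addLeaf_none [Fintype V] (hG : G.Connected) :
    transmission (addLeaf G u) none = transmission G u + Fintype.card V := by
  simp [transmission, Fintype.sum_option, addLeaf_dist hG, leafDist, Finset.sum_add_distrib]

theorem transmission_addLeaf_some [Fintype V] (hG : G.Connected) (v : V) :
    transmission (addLeaf G u) (some v) = transmission G v + G.dist v u + 1 := by
  simp [transmission, Fintype.sum_option, addLeaf_dist hG, leafDist]
  ring

/-- Old distances are unchanged, and the new vertex is one step farther than `u` from every old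
vertex. -/
theorem wienerIndex_addLeaf [Fintype V] (hG : G.Connected) :
    wienerIndex (addLeaf G u) = wienerIndex G + transmission G u + Fintype.card V := by
  have h := two_mul_wienerIndex (addLeaf G u)
  have h' := two_mul_wienerIndex G
  have hd : ∑ v, G.dist v u = transmission G u :=
    Finset.sum_congr rfl fun v _ => dist_comm
  simp only [Fintype.sum_option, transmission_addLeaf_none hG, transmission_addLeaf_some hG,
    Finset.sum_add_distrib, hd, Finset.sum_const, Finset.card_univ, smul_eq_mul, mul_one] at h
  omega

/-- Attaching pendant vertices at corresponding vertices of isomorphic graphs. -/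
def addLeafCongr {W : Type*} {H : SimpleGraph W} (φ : G ≃g H) (u : V) :
    addLeaf G u ≃g addLeaf H (φ u) where
  toEquiv := Equiv.optionCongr φ.toEquiv
  map_rel_iff' := by
    rintro (_ | a) (_ | b)
    · exact Iff.rfl
    · exact φ.injective.eq_iff
    · exact φ.injective.eq_iff
    · exact φ.map_adj_iff

/-- The order in which two pendant vertices are attached does not matter. -/
def addLeafSwap (G : SimpleGraph V) (u v : V) :
    addLeaf (addLeaf G u) (some v) ≃g addLeaf (addLeaf G v) (some u) where
  toFun
    | none => some none
    | some none => none
    | some (some x) => some (some x)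
  invFun
    | none => some none
    | some none => none
    | some (some x) => some (some x)
  left_inv := by rintro (_ | _ | x) <;> rfl
  right_inv := by rintro (_ | _ | x) <;> rfl
  map_rel_iff' := by rintro (_ | _ | x) (_ | _ | y) <;> simp

/-- An induced embedding extends over a pendant vertex. -/
def addLeafEmbedding {W : Type*} {T : SimpleGraph W} (f : G ↪g T) (x : W)
    (hx : ∀ w, f w ≠ x) (hadj : ∀ w, T.Adj x (f w) ↔ w = u) : addLeaf G u ↪g T where
  toFun o := o.elim x f
  inj' := by
    rintro (_ | a) (_ | b) h
    · rfl
    · exact absurd h.symm (hx b)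
    · exact absurd h (hx a)
    · exact congrArg some (f.injective h)
  map_rel_iff' := by
    rintro (_ | a) (_ | b)
    · simp
    · exact hadj b
    · exact (T.adj_comm _ _).trans (hadj a)
    · exact f.map_adj_iff

end addLeaf

/-- A walk leaving the image of `f` crosses its boundary at some edge from `f u` to `x`. A second
neighbour of `x` in the connected image would close a cycle, so `x` is a pendant vertex over the
image. -/
theorem exists_addLeafEmbedding {V W : Type*} [Fintype V] [Fintype W] {H : SimpleGraph V}
    {T : SimpleGraph W} (hH : H.Connected) (hT : T.IsTree) (f : H ↪g T)
    (hlt : Fintype.card V < Fintype.card W) :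
    ∃ (u : V) (g : addLeaf H u ↪g T), ∀ v, g (some v) = f v := by
  classical
  have hns : ¬ Function.Surjective f := fun hs =>
    absurd (Fintype.card_le_of_surjective f hs) (by omega)
  have hb : ∃ (u : V) (x : W), T.Adj (f u) x ∧ ∀ w, f w ≠ x := by
    simp only [Function.Surjective, not_forall, not_exists] at hns
    obtain ⟨y, hy⟩ := hns
    obtain ⟨v⟩ := hH.nonempty
    obtain ⟨p⟩ := hT.1 (f v) y
    obtain ⟨d, -, ⟨u, hu⟩, h2⟩ := p.exists_boundary_dart (Set.range f) ⟨v, rfl⟩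
      (by rintro ⟨w, hw⟩; exact hy w hw)
    exact ⟨u, d.snd, hu ▸ d.adj, fun w hw => h2 ⟨w, hw⟩⟩
  obtain ⟨u, x, hux, hx⟩ := hb
  refine ⟨u, addLeafEmbedding f x hx fun w => ⟨fun hw => ?_, ?_⟩, fun v => rfl⟩
  · by_contra hne
    -- Two paths join `f u` to `f w`, one inside the image and one through `x`; uniqueness of paths
    -- in a tree puts `x` in the image.
    obtain ⟨p, hp⟩ := (hH.preconnected u w).exists_isPath
    have hp' : (p.map f.toHom).IsPath := hp.map f.injective
    have hq : (Walk.cons hux (Walk.cons hw Walk.nil)).IsPath := by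
      simp [Walk.cons_isPath_iff, hux.ne, hw.ne, f.injective.ne (Ne.symm hne)]
    have heq := (hT.2.subsingleton_path _ _).elim ⟨_, hp'⟩ ⟨_, hq⟩
    have hmem : x ∈ (p.map f.toHom).support := by
      have : (p.map f.toHom) = Walk.cons hux (Walk.cons hw Walk.nil) := congrArg Subtype.val heq
      rw [this]; simp
    rw [Walk.support_map, List.mem_map] at hmem
    obtain ⟨v, -, hv⟩ := hmem
    exact hx v hv
  · rintro rfl; exact hux.symm

/-- An induced embedding between graphs of the same finite order is an isomorphism. -/
noncomputable def isoOfCard {V W : Type*} [Fintype V] [Fintype W] {G : SimpleGraph V}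
    {T : SimpleGraph W} (f : G ↪g T) (h : Fintype.card V = Fintype.card W) : G ≃g T :=
  RelIso.ofSurjective f (((Fintype.bijective_iff_injective_and_card f).2 ⟨f.injective, h⟩).2)

/-! ### Paths -/

/-- The reversal of a path. -/
def pathGraphRev (n : ℕ) : pathGraph n ≃g pathGraph n where
  toEquiv := Fin.revPerm
  map_rel_iff' := by
    intro a b
    simp only [pathGraph_adj, Fin.revPerm_apply, Fin.val_rev]
    omega

/-- A path on `n + 2` vertices arises by attaching a pendant vertex to an end of a path on `n + 1`
vertices. -/
noncomputable def addLeafPathGraphIso (n : ℕ) :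
    addLeaf (pathGraph (n + 1)) (Fin.last n) ≃g pathGraph (n + 2) :=
  isoOfCard (addLeafEmbedding
    { toFun := Fin.castSucc
      inj' := Fin.castSucc_injective _
      map_rel_iff' := by intro a b; simp [pathGraph_adj] }
    (Fin.last (n + 1)) (fun w => (Fin.castSucc_lt_last w).ne)
    (fun w => by
      change (pathGraph (n + 2)).Adj (Fin.last (n + 1)) w.castSucc ↔ _
      have := w.isLt
      rw [pathGraph_adj, Fin.ext_iff]
      simp only [Fin.val_last, Fin.val_castSucc]
      omega)) (by simp)

theorem pathGraph_isTree (n : ℕ) : (pathGraph (n + 1)).IsTree := by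
  induction n with
  | zero =>
    have : Subsingleton (Fin (0 + 1)) := inferInstanceAs (Subsingleton (Fin 1))
    exact IsTree.of_subsingleton
  | succ n ih => exact (addLeafPathGraphIso n).isTree_iff.1 (addLeaf_isTree ih)

/-- There are `i` positions to the left and `k` to the right, giving two triangular numbers. With
truncated subtraction, `(i - j) + (j - i)` is the absolute difference. -/
theorem two_mul_sum_range_dist (i k : ℕ) :
    2 * ∑ j ∈ Finset.range (i + 1 + k), ((i - j) + (j - i)) = i * (i + 1) + k * (k + 1) := by
  induction k with
  | zero =>
    induction i with
    | zero => simp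
    | succ i ih =>
      rw [add_zero, Finset.sum_range_succ']
      have : ∀ j, (i + 1 - (j + 1)) + (j + 1 - (i + 1)) = (i - j) + (j - i) := by
        intro j; omega
      rw [add_zero] at ih
      simp only [this]
      rw [mul_add, ih, Nat.zero_sub, Nat.sub_zero]
      ring
  | succ k ih =>
    rw [← add_assoc, Finset.sum_range_succ, mul_add, ih]
    have : (i - (i + 1 + k)) + (i + 1 + k - i) = k + 1 := by omega
    rw [this]
    ring

theorem two_mul_transmission_pathGraph {n : ℕ} (i : Fin n) {k : ℕ} (h : i.val + 1 + k = n) :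
    2 * transmission (pathGraph n) i = i.val * (i.val + 1) + k * (k + 1) := by
  simp only [transmission, pathGraph_dist]
  rw [Fin.sum_univ_eq_sum_range (fun j => (i.val - j) + (j - i.val)) n, ← two_mul_sum_range_dist]
  rw [h]

theorem six_mul_wienerIndex_pathGraph (n : ℕ) :
    6 * wienerIndex (pathGraph (n + 1)) = n * (n + 1) * (n + 2) := by
  induction n with
  | zero =>
    have := two_mul_wienerIndex (pathGraph 1)
    simp [transmission] at this
    simp [this]
  | succ n ih =>
    have h := wienerIndex_iso (addLeaf_connected (pathGraph_connected n)) (addLeafPathGraphIso n)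
    rw [wienerIndex_addLeaf (pathGraph_connected n), Fintype.card_fin] at h
    have h2 := two_mul_transmission_pathGraph (Fin.last n) (k := 0) (by simp)
    simp only [Fin.val_last] at h2
    rw [h, mul_add, mul_add, ih]
    nlinarith

/-- The transmission of an inner vertex of a path. -/
theorem two_mul_transmission_pathGraph_add {m : ℕ} (i : Fin (m + 2)) (h1 : 1 ≤ i.val)
    (hm : i.val ≤ m) :
    2 * (transmission (pathGraph (m + 2)) i + (i.val - 1) * (m - i.val)) = m * (m + 1) + 2 := by
  -- With `a = i - 1` and `b = m - i` the truncated subtractions disappear and a polynomial identity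
  -- remains.
  obtain ⟨a, ha⟩ := Nat.exists_eq_add_of_le h1
  obtain ⟨b, hb⟩ := Nat.exists_eq_add_of_le hm
  rw [mul_add, two_mul_transmission_pathGraph i (k := b + 1) (by omega)]
  rw [show i.val - 1 = a by omega, show m - i.val = b by omega, ha]
  have hmab : m = 1 + a + b := by omega
  simp only [hmab]
  ring

/-- A geodesic is isometrically embedded, so only consecutive vertices of it are adjacent and the
path is induced. -/
theorem exists_pathGraph_embedding {V : Type*} {T : SimpleGraph V}
    (hT : T.Connected) {d : ℕ} {a b : V} (hd : T.dist a b = d) :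
    Nonempty (pathGraph (d + 1) ↪g T) := by
  obtain ⟨p, hp⟩ := hT.exists_walk_length_eq_dist a b
  have hpd : p.length = d := hp.trans hd
  have key : ∀ i j, i ≤ j → j ≤ d → T.dist (p.getVert i) (p.getVert j) = j - i := by
    intro i j hij hj
    have h1 : T.dist a (p.getVert i) ≤ i :=
      (dist_le (p.take i)).trans (by simp)
    have h2 : T.dist (p.getVert j) b ≤ d - j :=
      (dist_le (p.drop j)).trans (by simp [hpd])
    have h3 : T.dist (p.getVert i) (p.getVert j) ≤ j - i := by
      have := dist_le (((p.drop i).take (j - i)))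
      refine le_trans (le_of_eq ?_) (this.trans (by simp))
      congr 1
      rw [Walk.drop_getVert]
      congr 1; omega
    -- The three upper bounds add up to `d`, the distance from `a` to `b`, so the triangle
    -- inequality makes each of them an equality.
    have h4 := hT.dist_triangle (u := a) (v := p.getVert i) (w := b)
    have h5 := hT.dist_triangle (u := p.getVert i) (v := p.getVert j) (w := b)
    omega
  have key' : ∀ i j, i ≤ d → j ≤ d →
      T.dist (p.getVert i) (p.getVert j) = (i - j) + (j - i) := by
    intro i j hi hj
    rcases le_total i j with h | h
    · rw [key i j h hj]; omega
    · rw [dist_comm, key j i h hi]; omega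
  refine ⟨{ toFun := fun i => p.getVert i.val, inj' := ?_, map_rel_iff' := ?_ }⟩
  · intro i j hij
    have := key' i j (by omega) (by omega)
    dsimp only at hij
    rw [hij, dist_self] at this
    exact Fin.ext (by omega)
  · intro i j
    change T.Adj (p.getVert i.val) (p.getVert j.val) ↔ _
    rw [← dist_eq_one_iff_adj, key' i j (by omega) (by omega), pathGraph_adj]
    omega

/-- A tree on `m + 5` vertices with diameter `m + 1` is a path with three vertices attached. -/
theorem InTreeFamily.exists_iso {V : Type*} [Fintype V] {T : SimpleGraph V} {m : ℕ}
    (h : InTreeFamily (m + 5) (m + 1) T) :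
    ∃ u₁ u₂ u₃, Nonempty (addLeaf (addLeaf (addLeaf (pathGraph (m + 2)) u₁) u₂) u₃ ≃g T) := by
  obtain ⟨hc, ht, hd⟩ := h
  have := ht.1.nonempty
  obtain ⟨a, b, hab⟩ := T.exists_dist_eq_diam
  obtain ⟨f⟩ := exists_pathGraph_embedding ht.1 (hab.trans hd)
  have c0 := pathGraph_connected (m + 1)
  obtain ⟨u₁, f₁, -⟩ := exists_addLeafEmbedding c0 ht f (by simp [hc])
  have c1 := addLeaf_connected (u := u₁) c0
  obtain ⟨u₂, f₂, -⟩ := exists_addLeafEmbedding c1 ht f₁ (by simp [hc])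
  have c2 := addLeaf_connected (u := u₂) c1
  obtain ⟨u₃, f₃, -⟩ := exists_addLeafEmbedding c2 ht f₂ (by simp [hc])
  exact ⟨u₁, u₂, u₃, ⟨isoOfCard f₃ (by simp [hc])⟩⟩

/-! ### Paths with three attached vertices -/

/-- The path on `m + 2` vertices with pendant vertices attached at `i`, `j` and `k`. -/
abbrev pathThreePendants (m : ℕ) (i j k : Fin (m + 2)) :
    SimpleGraph (Option (Option (Option (Fin (m + 2))))) :=
  addLeaf (addLeaf (addLeaf (pathGraph (m + 2)) i) (some j)) (some (some k))

/-- The path on `m + 2` vertices with a path of two vertices attached at `i` and a pendant vertex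
attached at `j`. -/
abbrev pathTailPendant (m : ℕ) (i j : Fin (m + 2)) :
    SimpleGraph (Option (Option (Option (Fin (m + 2))))) :=
  addLeaf (addLeaf (addLeaf (pathGraph (m + 2)) i) none) (some (some j))

/-- The path on `m + 2` vertices with the centre of a path of three vertices attached at `i`. -/
abbrev pathCherry (m : ℕ) (i : Fin (m + 2)) :
    SimpleGraph (Option (Option (Option (Fin (m + 2))))) :=
  addLeaf (addLeaf (addLeaf (pathGraph (m + 2)) i) none) (some none)

/-- The path on `m + 2` vertices with an end of a path of three vertices attached at `i`. -/
abbrev pathLongTail (m : ℕ) (i : Fin (m + 2)) :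
    SimpleGraph (Option (Option (Option (Fin (m + 2))))) :=
  addLeaf (addLeaf (addLeaf (pathGraph (m + 2)) i) none) none

theorem addLeaf_addLeaf_addLeaf_isTree {m : ℕ} (u₁ u₂ u₃) :
    (addLeaf (addLeaf (addLeaf (pathGraph (m + 2)) u₁) u₂) u₃).IsTree :=
  addLeaf_isTree (addLeaf_isTree (addLeaf_isTree (pathGraph_isTree (m + 1))))

theorem addLeaf_pathGraph_dist {m : ℕ} (u₁ : Fin (m + 2)) :
    (addLeaf (pathGraph (m + 2)) u₁).dist = leafDist (pathGraph (m + 2)).dist u₁ :=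
  addLeaf_dist (pathGraph_connected (m + 1))

theorem addLeaf_addLeaf_addLeaf_dist {m : ℕ} (u₁ : Fin (m + 2)) (u₂ u₃) :
    (addLeaf (addLeaf (addLeaf (pathGraph (m + 2)) u₁) u₂) u₃).dist =
      leafDist (leafDist (leafDist (pathGraph (m + 2)).dist u₁) u₂) u₃ := by
  have c0 : (pathGraph (m + 2)).Connected := pathGraph_connected (m + 1)
  rw [addLeaf_dist (addLeaf_connected (addLeaf_connected c0)), addLeaf_dist (addLeaf_connected c0),
    addLeaf_dist c0]

/-! ### Wiener indices of the four shapes -/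

theorem wienerIndex_addLeaf_addLeaf_addLeaf {m : ℕ} (u₁ u₂ u₃) :
    wienerIndex (addLeaf (addLeaf (addLeaf (pathGraph (m + 2)) u₁) u₂) u₃) =
      wienerIndex (pathGraph (m + 2)) + transmission (pathGraph (m + 2)) u₁
        + transmission (addLeaf (pathGraph (m + 2)) u₁) u₂
        + transmission (addLeaf (addLeaf (pathGraph (m + 2)) u₁) u₂) u₃ + 3 * m + 9 := by
  have c0 : (pathGraph (m + 2)).Connected := pathGraph_connected (m + 1)
  rw [wienerIndex_addLeaf (addLeaf_connected (addLeaf_connected c0)),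
    wienerIndex_addLeaf (addLeaf_connected c0), wienerIndex_addLeaf c0]
  simp only [Fintype.card_option, Fintype.card_fin]
  ring

theorem wienerIndex_pathThreePendants {m : ℕ} (i j k : Fin (m + 2)) :
    wienerIndex (pathThreePendants m i j k) =
      wienerIndex (pathGraph (m + 2)) + transmission (pathGraph (m + 2)) i
        + transmission (pathGraph (m + 2)) j + transmission (pathGraph (m + 2)) k
        + (i.val - j.val + (j.val - i.val)) + (i.val - k.val + (k.val - i.val))
        + (j.val - k.val + (k.val - j.val)) + 3 * m + 12 := by
  have c0 : (pathGraph (m + 2)).Connected := pathGraph_connected (m + 1)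
  rw [wienerIndex_addLeaf_addLeaf_addLeaf, transmission_addLeaf_some (addLeaf_connected c0),
    transmission_addLeaf_some c0, transmission_addLeaf_some c0]
  simp only [addLeaf_pathGraph_dist, leafDist, pathGraph_dist]
  ring

theorem wienerIndex_pathTailPendant {m : ℕ} (i j : Fin (m + 2)) :
    wienerIndex (pathTailPendant m i j) =
      wienerIndex (pathGraph (m + 2)) + 2 * transmission (pathGraph (m + 2)) i
        + transmission (pathGraph (m + 2)) j
        + 2 * (i.val - j.val + (j.val - i.val)) + 4 * m + 14 := by
  have c0 : (pathGraph (m + 2)).Connected := pathGraph_connected (m + 1)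
  rw [wienerIndex_addLeaf_addLeaf_addLeaf, transmission_addLeaf_some (addLeaf_connected c0),
    transmission_addLeaf_none c0, transmission_addLeaf_some c0]
  simp only [addLeaf_pathGraph_dist, leafDist, pathGraph_dist, Fintype.card_fin]
  ring

theorem wienerIndex_pathCherry {m : ℕ} (i : Fin (m + 2)) :
    wienerIndex (pathCherry m i) =
      wienerIndex (pathGraph (m + 2)) + 3 * transmission (pathGraph (m + 2)) i
        + 5 * m + 14 := by
  have c0 : (pathGraph (m + 2)).Connected := pathGraph_connected (m + 1)
  rw [wienerIndex_addLeaf_addLeaf_addLeaf, transmission_addLeaf_some (addLeaf_connected c0),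
    transmission_addLeaf_none c0]
  simp only [dist_self, Fintype.card_fin]
  ring

theorem wienerIndex_pathLongTail {m : ℕ} (i : Fin (m + 2)) :
    wienerIndex (pathLongTail m i) =
      wienerIndex (pathGraph (m + 2)) + 3 * transmission (pathGraph (m + 2)) i
        + 6 * m + 16 := by
  have c0 : (pathGraph (m + 2)).Connected := pathGraph_connected (m + 1)
  rw [wienerIndex_addLeaf_addLeaf_addLeaf, transmission_addLeaf_none (addLeaf_connected c0),
    transmission_addLeaf_none c0]
  simp only [Fintype.card_option, Fintype.card_fin]
  ring

/-! ### Constraints imposed by the diameter -/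

theorem InTreeFamily.dist_le {V : Type*} [Fintype V] {G : SimpleGraph V} {n d : ℕ}
    (h : InTreeFamily n d G) (u v : V) : G.dist u v ≤ d := by
  have := h.2.1.1.nonempty
  rw [← h.2.2]
  exact dist_le_diam (connected_iff_ediam_ne_top.1 h.2.1.1)

/-- A vertex at depth `h` over position `i` lies at distance `i + h` and `m + 1 - i + h` from the
two ends of the path. Neither exceeds `m + 1`, hence `h ≤ i ≤ m + 1 - h`; the same argument serves
the other three shapes. -/
theorem pathThreePendants_bounds {m : ℕ} {i j k : Fin (m + 2)}
    (h : InTreeFamily (m + 5) (m + 1) (pathThreePendants m i j k)) :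
    (1 ≤ i.val ∧ i.val ≤ m) ∧ (1 ≤ j.val ∧ j.val ≤ m) ∧ (1 ≤ k.val ∧ k.val ≤ m) := by
  have i1 := h.dist_le (some (some none)) (some (some (some 0)))
  have i2 := h.dist_le (some (some none)) (some (some (some (Fin.last (m + 1)))))
  have j1 := h.dist_le (some none) (some (some (some 0)))
  have j2 := h.dist_le (some none) (some (some (some (Fin.last (m + 1)))))
  have k1 := h.dist_le none (some (some (some 0)))
  have k2 := h.dist_le none (some (some (some (Fin.last (m + 1)))))
  simp only [addLeaf_addLeaf_addLeaf_dist, leafDist,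
    pathGraph_dist, Fin.val_last, Fin.val_zero] at i1 i2 j1 j2 k1 k2
  omega

theorem pathTailPendant_bounds {m : ℕ} {i j : Fin (m + 2)}
    (h : InTreeFamily (m + 5) (m + 1) (pathTailPendant m i j)) :
    (2 ≤ i.val ∧ i.val + 1 ≤ m) ∧ (1 ≤ j.val ∧ j.val ≤ m) := by
  have i1 := h.dist_le (some none) (some (some (some 0)))
  have i2 := h.dist_le (some none) (some (some (some (Fin.last (m + 1)))))
  have j1 := h.dist_le none (some (some (some 0)))
  have j2 := h.dist_le none (some (some (some (Fin.last (m + 1)))))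
  simp only [addLeaf_addLeaf_addLeaf_dist, leafDist,
    pathGraph_dist, Fin.val_last, Fin.val_zero] at i1 i2 j1 j2
  omega

theorem pathCherry_bounds {m : ℕ} {i : Fin (m + 2)}
    (h : InTreeFamily (m + 5) (m + 1) (pathCherry m i)) : 2 ≤ i.val ∧ i.val + 1 ≤ m := by
  have i1 := h.dist_le (some none) (some (some (some 0)))
  have i2 := h.dist_le (some none) (some (some (some (Fin.last (m + 1)))))
  simp only [addLeaf_addLeaf_addLeaf_dist, leafDist,
    pathGraph_dist, Fin.val_last, Fin.val_zero] at i1 i2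
  omega

theorem pathLongTail_bounds {m : ℕ} {i : Fin (m + 2)}
    (h : InTreeFamily (m + 5) (m + 1) (pathLongTail m i)) : 3 ≤ i.val ∧ i.val + 2 ≤ m := by
  have i1 := h.dist_le none (some (some (some 0)))
  have i2 := h.dist_le none (some (some (some (Fin.last (m + 1)))))
  simp only [addLeaf_addLeaf_addLeaf_dist, leafDist,
    pathGraph_dist, Fin.val_last, Fin.val_zero] at i1 i2
  omega

theorem InTreeFamily.exists_shape {V : Type*} [Fintype V] {T : SimpleGraph V} {m : ℕ}
    (h : InTreeFamily (m + 5) (m + 1) T) :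
    (∃ i j k, Nonempty (T ≃g pathThreePendants m i j k)) ∨
    (∃ i j, Nonempty (T ≃g pathTailPendant m i j)) ∨
    (∃ i, Nonempty (T ≃g pathCherry m i)) ∨ ∃ i, Nonempty (T ≃g pathLongTail m i) := by
  obtain ⟨i, u₂, u₃, ⟨φ⟩⟩ := h.exists_iso
  rcases u₂ with _ | j <;> rcases u₃ with _ | _ | k
  · exact Or.inr (Or.inr (Or.inr ⟨i, ⟨φ.symm⟩⟩))
  · exact Or.inr (Or.inr (Or.inl ⟨i, ⟨φ.symm⟩⟩))
  · exact Or.inr (Or.inl ⟨i, k, ⟨φ.symm⟩⟩)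
  -- Here the third vertex hangs on the second leaf. The leaf at `i` was attached first and is moved
  -- past the other two to become the last.
  · exact Or.inr (Or.inl ⟨j, i,
      ⟨φ.symm.trans (addLeafCongr (addLeafSwap (pathGraph (m + 2)) i j) none |>.trans
        (addLeafSwap (addLeaf (pathGraph (m + 2)) j) (some i) none))⟩⟩)
  · exact Or.inr (Or.inl ⟨i, j,
      ⟨φ.symm.trans (addLeafSwap (addLeaf (pathGraph (m + 2)) i) (some j) none)⟩⟩)
  · exact Or.inl ⟨i, j, k, ⟨φ.symm⟩⟩

/-! ### Symmetries of the shapes and the extremal tree -/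

def pathThreePendantsSwapLeft {m : ℕ} (i j k : Fin (m + 2)) :
    pathThreePendants m i j k ≃g pathThreePendants m j i k :=
  addLeafCongr (addLeafSwap (pathGraph (m + 2)) i j) (some (some k))

def pathThreePendantsSwapRight {m : ℕ} (i j k : Fin (m + 2)) :
    pathThreePendants m i j k ≃g pathThreePendants m i k j :=
  addLeafSwap (addLeaf (pathGraph (m + 2)) i) (some j) (some k)

def pathThreePendantsRev {m : ℕ} (i j k : Fin (m + 2)) :
    pathThreePendants m i j k ≃g pathThreePendants m i.rev j.rev k.rev :=
  addLeafCongr (addLeafCongr (addLeafCongr (pathGraphRev (m + 2)) i) (some j)) (some (some k))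

def pathTailPendantRev {m : ℕ} (i j : Fin (m + 2)) :
    pathTailPendant m i j ≃g pathTailPendant m i.rev j.rev :=
  addLeafCongr (addLeafCongr (addLeafCongr (pathGraphRev (m + 2)) i) none) (some (some j))

/-- The extremal tree: the path on `m + 2` vertices with one pendant vertex at the second vertex
and two pendant vertices at the second to last vertex. -/
abbrev extremalTree (m : ℕ) : SimpleGraph (Option (Option (Option (Fin (m + 2))))) :=
  pathThreePendants m 1 ⟨m, by omega⟩ ⟨m, by omega⟩

/-- Two attachment points coincide and the third differs; permuting the leaves and reversing the
path carries each of the six configurations to the standard one. -/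
theorem pathThreePendants_iso_extremalTree {m : ℕ} {i j k : Fin (m + 2)}
    (hi : i.val = 1 ∨ i.val = m) (hj : j.val = 1 ∨ j.val = m) (hk : k.val = 1 ∨ k.val = m)
    (hne : ¬ (i = j ∧ j = k)) : Nonempty (pathThreePendants m i j k ≃g extremalTree m) := by
  set b : Fin (m + 2) := ⟨m, by omega⟩ with hb
  have e : ∀ {x : Fin (m + 2)}, x.val = 1 ∨ x.val = m → x = 1 ∨ x = b := by
    rintro x (h | h)
    · exact Or.inl (Fin.ext (by simpa using h))
    · exact Or.inr (Fin.ext h)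
  have r1 : (1 : Fin (m + 2)).rev = b := Fin.ext (by simp [Fin.val_rev, hb])
  have rb : b.rev = 1 := by rw [← r1, Fin.rev_rev]
  have h1 : Nonempty (pathThreePendants m b 1 b ≃g extremalTree m) :=
    ⟨pathThreePendantsSwapLeft _ _ _⟩
  have h2 : Nonempty (pathThreePendants m b b 1 ≃g extremalTree m) :=
    ⟨(pathThreePendantsSwapRight _ _ _).trans h1.some⟩
  have h3 : ∀ {x y z : Fin (m + 2)}, Nonempty (pathThreePendants m x.rev y.rev z.rev ≃g
      extremalTree m) → Nonempty (pathThreePendants m x y z ≃g extremalTree m) := fun ⟨φ⟩ =>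
    ⟨(pathThreePendantsRev _ _ _).trans φ⟩
  rcases e hi with rfl | rfl <;> rcases e hj with rfl | rfl <;> rcases e hk with rfl | rfl
  · exact absurd ⟨rfl, rfl⟩ hne
  · exact h3 (by rw [r1, rb]; exact h2)
  · exact h3 (by rw [r1, rb]; exact h1)
  · exact ⟨RelIso.refl _⟩
  · exact h3 (by rw [r1, rb]; exact ⟨RelIso.refl _⟩)
  · exact h1
  · exact h2
  · exact absurd ⟨rfl, rfl⟩ hne

/-! ### Comparison of Wiener indices -/

theorem six_mul_wienerIndex_extremalTree {m : ℕ} (hm : 1 ≤ m) :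
    6 * wienerIndex (extremalTree m) =
      (m + 1) * (m + 2) * (m + 3) + 9 * (m * (m + 1)) + 30 * m + 78 := by
  have h1 := two_mul_transmission_pathGraph_add (m := m) 1 (by simp) (by simpa using hm)
  have h2 := two_mul_transmission_pathGraph_add (m := m) ⟨m, by omega⟩ hm le_rfl
  have h3 := six_mul_wienerIndex_pathGraph (m + 1)
  rw [wienerIndex_pathThreePendants]
  simp only [Fin.val_one, Nat.sub_self, zero_mul, mul_zero, add_zero] at h1 h2 ⊢
  rw [show m + 1 + 1 = m + 2 from rfl, show m + 1 + 2 = m + 3 from rfl] at h3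
  omega

theorem wienerIndex_extremalTree {m : ℕ} (hm : 1 ≤ m) :
    wienerIndex (extremalTree m) =
      wienerIndex (pathGraph (m + 2)) + 3 * transmission (pathGraph (m + 2)) 1 + 5 * m + 10 := by
  have h1 := two_mul_transmission_pathGraph_add (m := m) 1 (by simp) (by simpa using hm)
  have h2 := two_mul_transmission_pathGraph_add (m := m) ⟨m, by omega⟩ hm le_rfl
  rw [wienerIndex_pathThreePendants]
  simp only [Fin.val_one, Nat.sub_self, zero_mul, mul_zero, add_zero] at h1 h2 ⊢
  omega

theorem transmission_pathGraph_add {m : ℕ} (hm : 1 ≤ m) (i : Fin (m + 2)) (h1 : 1 ≤ i.val)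
    (h2 : i.val ≤ m) : transmission (pathGraph (m + 2)) i + (i.val - 1) * (m - i.val) =
      transmission (pathGraph (m + 2)) 1 := by
  have h := two_mul_transmission_pathGraph_add i h1 h2
  have h' := two_mul_transmission_pathGraph_add (m := m) 1 (by simp) (by simpa using hm)
  simp only [Fin.val_one, Nat.sub_self, zero_mul, add_zero] at h'
  omega

/-- The pairwise distances sum to twice the spread of the three positions, at most `2(m - 1)`.
Equality forces zero loss, so all positions are 1 or `m`. -/
theorem wienerIndex_pathThreePendants_le {m : ℕ} {i j k : Fin (m + 2)}
    (hi : 1 ≤ i.val ∧ i.val ≤ m) (hj : 1 ≤ j.val ∧ j.val ≤ m) (hk : 1 ≤ k.val ∧ k.val ≤ m)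
    (hm : 2 ≤ m) : wienerIndex (pathThreePendants m i j k) ≤ wienerIndex (extremalTree m) ∧
      (wienerIndex (pathThreePendants m i j k) = wienerIndex (extremalTree m) →
        Nonempty (pathThreePendants m i j k ≃g extremalTree m)) := by
  have ti := transmission_pathGraph_add (by omega) i hi.1 hi.2
  have tj := transmission_pathGraph_add (by omega) j hj.1 hj.2
  have tk := transmission_pathGraph_add (by omega) k hk.1 hk.2
  have z : ∀ x : Fin (m + 2), 1 ≤ x.val ∧ x.val ≤ m → (x.val - 1) * (m - x.val) = 0 →
      x.val = 1 ∨ x.val = m := by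
    intro x hx h
    rcases Nat.mul_eq_zero.1 h with h | h <;> omega
  rw [wienerIndex_pathThreePendants, wienerIndex_extremalTree (by omega)]
  refine ⟨by omega, fun h => ?_⟩
  refine pathThreePendants_iso_extremalTree (z i hi (by omega)) (z j hj (by omega))
    (z k hk (by omega)) ?_
  -- If all three positions agree, the distances vanish and `3m + 12 < 5m + 10` since `m ≥ 2`.
  rintro ⟨rfl, rfl⟩
  omega

/-- The gain `2|i - j|` is at most `2(m - 2)`, and it is offset by twice the loss at `i`, which is
at least `m - 2`. What remains is `4m + 14 ≤ 5m + 10`, with equality only for `m = 4`. -/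
theorem wienerIndex_pathTailPendant_le {m : ℕ} {i j : Fin (m + 2)}
    (hi : 2 ≤ i.val ∧ i.val + 1 ≤ m) (hj : 1 ≤ j.val ∧ j.val ≤ m) (hm : 4 ≤ m) :
    wienerIndex (pathTailPendant m i j) ≤ wienerIndex (extremalTree m) ∧
      (wienerIndex (pathTailPendant m i j) = wienerIndex (extremalTree m) →
        m = 4 ∧ Nonempty (pathTailPendant m i j ≃g pathTailPendant m 2 ⟨m, by omega⟩)) := by
  have ti := transmission_pathGraph_add (by omega) i (by omega) (by omega)
  have tj := transmission_pathGraph_add (by omega) j hj.1 hj.2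
  have hp : m - 2 ≤ (i.val - 1) * (m - i.val) := by
    obtain ⟨a, ha⟩ := Nat.exists_eq_add_of_le hi.1
    obtain ⟨b, hb⟩ := Nat.exists_eq_add_of_le hi.2
    rw [show i.val - 1 = a + 1 by omega, show m - i.val = b + 1 by omega]
    have : m - 2 = a + b + 1 := by omega
    nlinarith
  rw [wienerIndex_pathTailPendant, wienerIndex_extremalTree (by omega)]
  refine ⟨by omega, fun h => ?_⟩
  have hm4 : m = 4 := by omega
  subst hm4
  refine ⟨rfl, ?_⟩
  -- Equality forces `|i - j| = 2` and no loss at `j`; the two solutions are mirror images.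
  have hij : (i.val = 2 ∧ j.val = 4) ∨ (i.val = 3 ∧ j.val = 1) := by omega
  rcases hij with ⟨h1, h2⟩ | ⟨h1, h2⟩
  · rw [show i = 2 from Fin.ext h1, show j = ⟨4, by omega⟩ from Fin.ext h2]
    exact ⟨RelIso.refl _⟩
  · rw [show i = 3 from Fin.ext h1, show j = 1 from Fin.ext h2]
    exact ⟨pathTailPendantRev 3 1⟩

/-- The loss is at least 2 and counts three times, while the constant exceeds that of the extremal
tree by only 4. -/
theorem wienerIndex_pathCherry_lt {m : ℕ} {i : Fin (m + 2)}
    (hi : 2 ≤ i.val ∧ i.val + 1 ≤ m) (hm : 4 ≤ m) :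
    wienerIndex (pathCherry m i) < wienerIndex (extremalTree m) := by
  have ti := transmission_pathGraph_add (by omega) i (by omega) (by omega)
  have hp : 2 ≤ (i.val - 1) * (m - i.val) := by
    obtain ⟨a, ha⟩ := Nat.exists_eq_add_of_le hi.1
    obtain ⟨b, hb⟩ := Nat.exists_eq_add_of_le hi.2
    rw [show i.val - 1 = a + 1 by omega, show m - i.val = b + 1 by omega]
    have : 4 ≤ 2 + a + 1 + b := by omega
    nlinarith
  rw [wienerIndex_pathCherry, wienerIndex_extremalTree (by omega)]
  omega

/-- Three times the loss is at least `6(m - 3)`, which leaves at most `34 < 5m + 10`, because the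
bounds on `i` force `m ≥ 5`. -/
theorem wienerIndex_pathLongTail_lt {m : ℕ} {i : Fin (m + 2)}
    (hi : 3 ≤ i.val ∧ i.val + 2 ≤ m) :
    wienerIndex (pathLongTail m i) < wienerIndex (extremalTree m) := by
  have ti := transmission_pathGraph_add (by omega) i (by omega) (by omega)
  have hp : 2 * (m - 3) ≤ (i.val - 1) * (m - i.val) := by
    obtain ⟨a, ha⟩ := Nat.exists_eq_add_of_le hi.1
    obtain ⟨b, hb⟩ := Nat.exists_eq_add_of_le hi.2
    rw [show i.val - 1 = a + 2 by omega, show m - i.val = b + 2 by omega]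
    have : m - 3 = a + b + 2 := by omega
    nlinarith
  rw [wienerIndex_pathLongTail, wienerIndex_extremalTree (by omega)]
  omega

theorem InTreeFamily.wienerIndex_le {V : Type*} [Fintype V] {T : SimpleGraph V} {m : ℕ}
    (h : InTreeFamily (m + 5) (m + 1) T) (hm : 4 ≤ m) :
    wienerIndex T ≤ wienerIndex (extremalTree m) ∧
      (wienerIndex T = wienerIndex (extremalTree m) →
        Nonempty (T ≃g extremalTree m) ∨
          m = 4 ∧ Nonempty (T ≃g pathTailPendant m 2 ⟨m, by omega⟩)) := by
  rcases h.exists_shape with ⟨i, j, k, ⟨φ⟩⟩ | ⟨i, j, ⟨φ⟩⟩ | ⟨i, ⟨φ⟩⟩ | ⟨i, ⟨φ⟩⟩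
  · obtain ⟨hi, hj, hk⟩ := pathThreePendants_bounds (h.of_iso φ)
    have := wienerIndex_pathThreePendants_le hi hj hk (by omega)
    rw [wienerIndex_iso h.2.1.1 φ] at this
    exact ⟨this.1, fun e => Or.inl ((this.2 e).map φ.trans)⟩
  · obtain ⟨hi, hj⟩ := pathTailPendant_bounds (h.of_iso φ)
    have := wienerIndex_pathTailPendant_le hi hj hm
    rw [wienerIndex_iso h.2.1.1 φ] at this
    exact ⟨this.1, fun e => Or.inr ⟨(this.2 e).1, (this.2 e).2.map φ.trans⟩⟩
  · have := wienerIndex_pathCherry_lt (pathCherry_bounds (h.of_iso φ)) hm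
    rw [wienerIndex_iso h.2.1.1 φ] at this
    exact ⟨this.le, fun e => absurd e this.ne⟩
  · have := wienerIndex_pathLongTail_lt (pathLongTail_bounds (h.of_iso φ))
    rw [wienerIndex_iso h.2.1.1 φ] at this
    exact ⟨this.le, fun e => absurd e this.ne⟩

/-! ### Membership of the candidates in the family -/

theorem extremalTree_inTreeFamily {m : ℕ} (hm : 1 ≤ m) :
    InTreeFamily (m + 5) (m + 1) (extremalTree m) := by
  have ht : (extremalTree m).IsTree := addLeaf_addLeaf_addLeaf_isTree _ _ _
  refine ⟨by simp, ht, diam_eq_of_forall_le ht.1 ?_ (a := some (some (some 0)))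
    (b := some (some (some (Fin.last (m + 1))))) ?_⟩
  · rintro (_ | _ | _ | a) (_ | _ | _ | b) <;>
    simp only [addLeaf_addLeaf_addLeaf_dist, leafDist,
      pathGraph_dist, Fin.val_one] <;> omega
  · simp only [addLeaf_addLeaf_addLeaf_dist, leafDist,
      pathGraph_dist, Fin.val_last, Fin.val_zero]
    omega

theorem pathTailPendant_inTreeFamily {m : ℕ} {i j : Fin (m + 2)}
    (hi : 2 ≤ i.val ∧ i.val + 1 ≤ m) (hj : 1 ≤ j.val ∧ j.val ≤ m) :
    InTreeFamily (m + 5) (m + 1) (pathTailPendant m i j) := by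
  have ht : (pathTailPendant m i j).IsTree := addLeaf_addLeaf_addLeaf_isTree _ _ _
  refine ⟨by simp, ht, diam_eq_of_forall_le ht.1 ?_ (a := some (some (some 0)))
    (b := some (some (some (Fin.last (m + 1))))) ?_⟩
  · rintro (_ | _ | _ | a) (_ | _ | _ | b) <;>
    simp only [addLeaf_addLeaf_addLeaf_dist, leafDist, pathGraph_dist] <;> omega
  · simp only [addLeaf_addLeaf_addLeaf_dist, leafDist, pathGraph_dist, Fin.val_last, Fin.val_zero]
    omega

/-! ### The trees `T₇` and `T₉` -/

/-- A longest path of the caterpillar `T(2, 3, m)`. -/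
def caterpillarSpine (m : ℕ) (i : Fin (m + 2)) : Fin m ⊕ (Fin 2 ⊕ Fin 3) :=
  if h : 1 ≤ i.val ∧ i.val ≤ m then .inl ⟨i.val - 1, by omega⟩
  else if i.val = 0 then .inr (.inl 0) else .inr (.inr 0)

theorem caterpillarSpine_cases {m : ℕ} (i : Fin (m + 2)) :
    (∃ h : i.val - 1 < m, 1 ≤ i.val ∧ i.val ≤ m ∧ caterpillarSpine m i = .inl ⟨i.val - 1, h⟩) ∨
    (i.val = 0 ∧ caterpillarSpine m i = .inr (.inl 0)) ∨
    (i.val = m + 1 ∧ caterpillarSpine m i = .inr (.inr 0)) := by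
  unfold caterpillarSpine
  by_cases h : 1 ≤ i.val ∧ i.val ≤ m
  · exact Or.inl ⟨by omega, h.1, h.2, by rw [dif_pos h]⟩
  · by_cases h0 : i.val = 0
    · exact Or.inr (Or.inl ⟨h0, by rw [dif_neg h, if_pos h0]⟩)
    · exact Or.inr (Or.inr ⟨by omega, by rw [dif_neg h, if_neg h0]⟩)

/-- The longest path as an induced subgraph of the caterpillar. -/
def caterpillarSpineEmbedding {m : ℕ} (hm : 1 ≤ m) :
    pathGraph (m + 2) ↪g caterpillarT 2 3 m where
  toFun := caterpillarSpine m
  inj' := by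
    intro i j hij
    rcases caterpillarSpine_cases i with ⟨_, hi1, hi2, hi⟩ | ⟨hi1, hi⟩ | ⟨hi1, hi⟩ <;>
    rcases caterpillarSpine_cases j with ⟨_, hj1, hj2, hj⟩ | ⟨hj1, hj⟩ | ⟨hj1, hj⟩ <;>
    rw [hi, hj] at hij <;> simp at hij <;> exact Fin.ext (by omega)
  map_rel_iff' := by
    intro i j
    change (caterpillarT 2 3 m).Adj (caterpillarSpine m i) (caterpillarSpine m j) ↔ _
    rw [pathGraph_adj]
    rcases caterpillarSpine_cases i with ⟨_, hi1, hi2, hi⟩ | ⟨hi1, hi⟩ | ⟨hi1, hi⟩ <;>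
    rcases caterpillarSpine_cases j with ⟨_, hj1, hj2, hj⟩ | ⟨hj1, hj⟩ | ⟨hj1, hj⟩ <;>
    rw [hi, hj] <;> simp [caterpillarT, fromRel_adj] <;> omega

/-- The longest path uses one pendant vertex at each end of the caterpillar. One pendant at the left
end and two at the right remain, and they are adjoined in turn. -/
theorem nonempty_extremalTree_iso_caterpillarT {m : ℕ} (hm : 1 ≤ m) :
    Nonempty (extremalTree m ≃g caterpillarT 2 3 m) := by
  let f := caterpillarSpineEmbedding hm
  have hf : ∀ i, f i = caterpillarSpine m i := fun _ => rfl
  let f₁ : addLeaf (pathGraph (m + 2)) 1 ↪g caterpillarT 2 3 m :=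
    addLeafEmbedding f (.inr (.inl 1))
      (by
        intro i
        rw [hf]
        rcases caterpillarSpine_cases i with ⟨_, _, _, hi⟩ | ⟨_, hi⟩ | ⟨_, hi⟩ <;> simp [hi])
      (by
        intro i
        rw [hf, Fin.ext_iff, Fin.val_one]
        rcases caterpillarSpine_cases i with ⟨_, _, _, hi⟩ | ⟨_, hi⟩ | ⟨_, hi⟩ <;>
        rw [hi] <;> simp [caterpillarT, fromRel_adj] <;> omega)
  have hf₁ : f₁ none = .inr (.inl 1) ∧ ∀ i, f₁ (some i) = caterpillarSpine m i :=
    ⟨rfl, fun _ => rfl⟩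
  let f₂ : addLeaf (addLeaf (pathGraph (m + 2)) 1) (some ⟨m, by omega⟩) ↪g caterpillarT 2 3 m :=
    addLeafEmbedding f₁ (.inr (.inr 1))
      (by
        rintro (_ | i)
        · simp [hf₁]
        rw [hf₁.2]
        rcases caterpillarSpine_cases i with ⟨_, _, _, hi⟩ | ⟨_, hi⟩ | ⟨_, hi⟩ <;> simp [hi])
      (by
        rintro (_ | i)
        · rw [hf₁.1]; simp [caterpillarT, fromRel_adj]
        rw [hf₁.2, Option.some_inj, Fin.ext_iff]
        rcases caterpillarSpine_cases i with ⟨_, _, _, hi⟩ | ⟨_, hi⟩ | ⟨_, hi⟩ <;>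
        rw [hi] <;> simp [caterpillarT, fromRel_adj] <;> omega)
  have hf₂ : f₂ none = .inr (.inr 1) ∧ f₂ (some none) = .inr (.inl 1) ∧
      ∀ i, f₂ (some (some i)) = caterpillarSpine m i := ⟨rfl, rfl, fun _ => rfl⟩
  let f₃ : extremalTree m ↪g caterpillarT 2 3 m :=
    addLeafEmbedding f₂ (.inr (.inr 2))
      (by
        rintro (_ | _ | i)
        · simp [hf₂]
        · simp [hf₂]
        rw [hf₂.2.2]
        rcases caterpillarSpine_cases i with ⟨_, _, _, hi⟩ | ⟨_, hi⟩ | ⟨_, hi⟩ <;> simp [hi])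
      (by
        rintro (_ | _ | i)
        · rw [hf₂.1]; simp [caterpillarT, fromRel_adj]
        · rw [hf₂.2.1]; simp [caterpillarT, fromRel_adj]
        rw [hf₂.2.2, Option.some_inj, Option.some_inj, Fin.ext_iff]
        rcases caterpillarSpine_cases i with ⟨_, _, _, hi⟩ | ⟨_, hi⟩ | ⟨_, hi⟩ <;>
        rw [hi] <;> simp [caterpillarT, fromRel_adj] <;> omega)
  exact ⟨isoOfCard f₃ (by simp)⟩

theorem treeT9_adj_inl_inl (i j : Fin 6) :
    (treeT9 9).Adj (.inl i) (.inl j) ↔ i.val + 1 = j.val ∨ j.val + 1 = i.val := by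
  simp only [treeT9, fromRel_adj, ne_eq, Sum.inl.injEq, Fin.ext_iff]
  omega

theorem treeT9_adj_inl_inr (i : Fin 6) (j : Fin 3) :
    (treeT9 9).Adj (.inl i) (.inr j) ↔
      (i.val = 2 ∧ j.val = 0) ∨ (i.val = 4 ∧ j.val = 2) := by
  simp only [treeT9, fromRel_adj, ne_eq, reduceCtorEq, Fin.ext_iff]
  simp

theorem treeT9_adj_inr_inr (i j : Fin 3) :
    (treeT9 9).Adj (.inr i) (.inr j) ↔
      (i.val = 0 ∧ j.val = 1) ∨ (j.val = 0 ∧ i.val = 1) := by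
  simp only [treeT9, fromRel_adj, ne_eq, Sum.inr.injEq, Fin.ext_iff]
  simp
  omega

theorem treeT9_adj_inr_inl (i : Fin 3) (j : Fin 6) :
    (treeT9 9).Adj (.inr i) (.inl j) ↔
      (j.val = 2 ∧ i.val = 0) ∨ (j.val = 4 ∧ i.val = 2) := by
  rw [adj_comm, treeT9_adj_inl_inr]

theorem nonempty_pathTailPendant_iso_treeT9 :
    Nonempty (pathTailPendant 4 2 ⟨4, by omega⟩ ≃g treeT9 9) := by
  have v2 : ∀ i : Fin 6, i = 2 ↔ i.val = 2 := fun i => Fin.ext_iff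
  have v4 : ∀ i : Fin 6, i = ⟨4, by omega⟩ ↔ i.val = 4 := fun i => Fin.ext_iff
  let f : pathGraph 6 ↪g treeT9 9 :=
    { toFun := Sum.inl
      inj' := Sum.inl_injective
      map_rel_iff' := by
        intro i j
        exact (treeT9_adj_inl_inl i j).trans pathGraph_adj.symm }
  have hf : ∀ i, f i = .inl i := fun _ => rfl
  let f₁ : addLeaf (pathGraph 6) 2 ↪g treeT9 9 :=
    addLeafEmbedding f (.inr 0) (by simp [hf])
      (by intro i; rw [hf, treeT9_adj_inr_inl, v2]; simp)
  have hf₁ : f₁ none = .inr 0 ∧ ∀ i, f₁ (some i) = .inl i := ⟨rfl, fun _ => rfl⟩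
  let f₂ : addLeaf (addLeaf (pathGraph 6) 2) none ↪g treeT9 9 :=
    addLeafEmbedding f₁ (.inr 1) (by rintro (_ | i) <;> simp [hf₁])
      (by
        rintro (_ | i)
        · rw [hf₁.1, treeT9_adj_inr_inr]; simp
        · rw [hf₁.2, treeT9_adj_inr_inl]; simp)
  have hf₂ : f₂ none = .inr 1 ∧ f₂ (some none) = .inr 0 ∧ ∀ i, f₂ (some (some i)) = .inl i :=
    ⟨rfl, rfl, fun _ => rfl⟩
  let f₃ : pathTailPendant 4 2 ⟨4, by omega⟩ ↪g treeT9 9 :=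
    addLeafEmbedding f₂ (.inr 2) (by rintro (_ | _ | i) <;> simp [hf₂])
      (by
        rintro (_ | _ | i)
        · rw [hf₂.1, treeT9_adj_inr_inr]; simp
        · rw [hf₂.2.1, treeT9_adj_inr_inr]; simp
        · rw [hf₂.2.2, treeT9_adj_inr_inl, Option.some_inj, Option.some_inj, v4]; simp)
  exact ⟨isoOfCard f₃ (by simp)⟩

/-- The maximum degree of `T₉` is at most three. -/
theorem treeT9_not_four_neighbors (v a b c d : Fin (9 - 3) ⊕ Fin 3)
    (ha : (treeT9 9).Adj v a) (hb : (treeT9 9).Adj v b) (hc : (treeT9 9).Adj v c)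
    (hd : (treeT9 9).Adj v d) : a = b ∨ a = c ∨ a = d ∨ b = c ∨ b = d ∨ c = d := by
  rcases v with v | v <;> rcases a with a | a <;> rcases b with b | b <;>
  rcases c with c | c <;> rcases d with d | d <;>
  simp only [treeT9_adj_inl_inl, treeT9_adj_inl_inr, treeT9_adj_inr_inl, treeT9_adj_inr_inr]
    at ha hb hc hd <;>
  simp only [Sum.inl.injEq, Sum.inr.injEq, reduceCtorEq, Fin.ext_iff] <;> omega

/-- The spine end carrying three pendants has degree four in `T₇`, whereas degrees in `T₉` are at
most three. -/
theorem not_nonempty_treeT7_iso_treeT9 : ¬ Nonempty (treeT7 9 ≃g treeT9 9) := by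
  rintro ⟨φ⟩
  have hadj : ∀ w, (treeT7 9).Adj (.inl 3) w → (treeT9 9).Adj (φ (.inl 3)) (φ w) :=
    fun w h => φ.map_adj_iff.2 h
  have h := treeT9_not_four_neighbors (φ (.inl 3)) (φ (.inl 2)) (φ (.inr (.inr 0)))
    (φ (.inr (.inr 1))) (φ (.inr (.inr 2)))
    (hadj _ (by simp [treeT7, caterpillarT, fromRel_adj]))
    (hadj _ (by simp [treeT7, caterpillarT, fromRel_adj]))
    (hadj _ (by simp [treeT7, caterpillarT, fromRel_adj]))
    (hadj _ (by simp [treeT7, caterpillarT, fromRel_adj]))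
  simp only [φ.injective.eq_iff] at h
  simp at h

end WienerTrees

theorem mainTheorem2 :
    (∀ n : ℕ, 10 ≤ n →
      WienerTrees.InTreeFamily n (n - 4) (WienerTrees.treeT7 n) ∧
      (WienerTrees.wienerIndex (WienerTrees.treeT7 n) : ℚ) =
        ((n : ℚ) ^ 3 - 25 * (n : ℚ) + 84) / 6 ∧
      ∀ (V : Type*) [Fintype V] (T : SimpleGraph V),
        WienerTrees.InTreeFamily n (n - 4) T →
          WienerTrees.wienerIndex T ≤ WienerTrees.wienerIndex (WienerTrees.treeT7 n) ∧
          (WienerTrees.wienerIndex T = WienerTrees.wienerIndex (WienerTrees.treeT7 n) ↔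
            Nonempty (T ≃g WienerTrees.treeT7 n))) ∧
    (WienerTrees.InTreeFamily 9 5 (WienerTrees.treeT7 9) ∧
      WienerTrees.InTreeFamily 9 5 (WienerTrees.treeT9 9) ∧
      ¬ Nonempty (WienerTrees.treeT7 9 ≃g WienerTrees.treeT9 9) ∧
      WienerTrees.wienerIndex (WienerTrees.treeT7 9) = 98 ∧
      WienerTrees.wienerIndex (WienerTrees.treeT9 9) = 98 ∧
      ∀ (V : Type*) [Fintype V] (T : SimpleGraph V),
        WienerTrees.InTreeFamily 9 5 T →
          WienerTrees.wienerIndex T ≤ 98 ∧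
          (WienerTrees.wienerIndex T = 98 ↔
            Nonempty (T ≃g WienerTrees.treeT7 9) ∨ Nonempty (T ≃g WienerTrees.treeT9 9))) := by
  open WienerTrees in
  refine ⟨fun n hn => ?_, ?_⟩
  · obtain ⟨m, rfl⟩ : ∃ m, n = m + 5 := ⟨n - 5, by omega⟩
    obtain ⟨φ⟩ : Nonempty (extremalTree m ≃g treeT7 (m + 5)) :=
      nonempty_extremalTree_iso_caterpillarT (by omega)
    have hE := extremalTree_inTreeFamily (m := m) (by omega)
    have hW := wienerIndex_iso hE.2.1.1 φ
    rw [show m + 5 - 4 = m + 1 by omega]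
    refine ⟨hE.of_iso φ, ?_, fun V _ T hT => ?_⟩
    · have h6 : (6 : ℚ) * wienerIndex (extremalTree m) =
          (m + 1) * (m + 2) * (m + 3) + 9 * (m * (m + 1)) + 30 * m + 78 := by
        exact_mod_cast six_mul_wienerIndex_extremalTree (m := m) (by omega)
      rw [hW]
      push_cast
      linarith
    · have h := hT.wienerIndex_le (by omega)
      rw [hW]
      refine ⟨h.1, fun e => ?_, fun ⟨ψ⟩ => by rw [← hW, wienerIndex_iso hT.2.1.1 ψ]⟩
      -- The exceptional tree needs `m = 4`, that is `n = 9`, which `hn` excludes.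
      rcases h.2 e with ⟨⟨ψ⟩⟩ | ⟨h4, -⟩
      · exact ⟨ψ.trans φ⟩
      · omega
  · obtain ⟨φ⟩ : Nonempty (extremalTree 4 ≃g treeT7 9) :=
      nonempty_extremalTree_iso_caterpillarT (by omega)
    obtain ⟨χ⟩ := nonempty_pathTailPendant_iso_treeT9
    have hE := extremalTree_inTreeFamily (m := 4) (by omega)
    have hP := pathTailPendant_inTreeFamily (m := 4) (i := 2) (j := ⟨4, by omega⟩)
      (by simp) (by simp)
    have h98 : wienerIndex (extremalTree 4) = 98 := by
      have := six_mul_wienerIndex_extremalTree (m := 4) (by omega)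
      omega
    have h98' : wienerIndex (pathTailPendant 4 2 ⟨4, by omega⟩) = 98 := by
      -- The loss is 2 at position 2 and 0 at position 4, so the index can be compared with the
      -- known value 98 of the extremal tree.
      have h1 := transmission_pathGraph_add (m := 4) (by omega) 2 (by simp) (by simp)
      have h2 := transmission_pathGraph_add (m := 4) (by omega) ⟨4, by omega⟩ (by simp) (by simp)
      rw [wienerIndex_extremalTree (by omega)] at h98
      rw [wienerIndex_pathTailPendant]
      simp at h1 h2 h98 ⊢
      omega
    have hW := wienerIndex_iso hE.2.1.1 φ
    have hW' := wienerIndex_iso hP.2.1.1 χ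
    rw [h98] at hW
    rw [h98'] at hW'
    refine ⟨hE.of_iso φ, hP.of_iso χ, not_nonempty_treeT7_iso_treeT9, hW, hW',
      fun V _ T hT => ?_⟩
    have h := InTreeFamily.wienerIndex_le (m := 4) hT le_rfl
    rw [h98] at h
    refine ⟨h.1, fun e => ?_, ?_⟩
    · rcases h.2 e with ⟨⟨ψ⟩⟩ | ⟨-, ⟨ψ⟩⟩
      · exact Or.inl ⟨ψ.trans φ⟩
      · exact Or.inr ⟨ψ.trans χ⟩
    · rintro (⟨⟨ψ⟩⟩ | ⟨⟨ψ⟩⟩)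
      · rw [← hW, wienerIndex_iso hT.2.1.1 ψ]
      · rw [← hW', wienerIndex_iso hT.2.1.1 ψ]
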